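/- Let $X$ be a compact metrizable space and let $G$ be a group acting on $X$ by homeomorphisms. For a Borel probability measure $\alpha$ on $X$ and $g \in G$ let $g\alpha$ denote the image of $\alpha$ under $x \mapsto gx$, and let $\|\cdot\|$ denote the total variation norm $\|\sigma\| = |\sigma|(X)$ on finite signed Borel measures on $X$ (so that $\|\alpha-\beta\| = 2$ for mutually singular probability measures $\alpha,\beta$). If $\alpha$ is a Borel probability measure on $X$ such that, for some $\delta > 0$, $\|g\alpha - \alpha\| \le 2 - \delta$ for all $g \in G$, then there exists a $G$-invariant Borel probability measure on $X$. -/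

import Mathlib

open MeasureTheory

noncomputable section

/-- The total variation norm `‖s‖ = |s|(X)` of a finite signed measure `s`, where `|s| = s⁺ + s⁻`
comes from the Jordan decomposition. For mutually singular probability measures `α`, `β` one has
`‖α - β‖ = 2`. -/
def tvNorm {X : Type*} [MeasurableSpace X] (s : SignedMeasure X) : ℝ :=
  (s.totalVariation Set.univ).toReal

/-- The translate `gα` of a measure: `(gα)(A) = α(g⁻¹A)`, the image of `α` under `x ↦ g • x`. -/
def measureTranslate {G X : Type*} [SMul G X] [MeasurableSpace X] (g : G) (α : Measure X) : Measure X :=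
  α.map (fun x => g • x)

instance measureTranslate_isFinite {G X : Type*} [SMul G X] [MeasurableSpace X] (g : G) (α : Measure X)
    [IsFiniteMeasure α] : IsFiniteMeasure (measureTranslate g α) := by
  unfold measureTranslate; infer_instance

end

open scoped ENNReal InnerProductSpace

/-! Invariance under each `g` is a weak-* closed condition on the compact space of probability
measures, so it suffices to treat finitely generated, hence countable, subgroups `H`. For such `H`
there is a finite quasi-invariant measure `ν` dominating all translates of `α`, and `H` acts
isometrically on half-densities in `L²(ν)`, sending `√α` to `√(gα)`. The minimal-norm point `v` of
the closed convex hull of this orbit is fixed. The bound `2 - δ` forces `⟪√(gα), √α⟫ ≥ δ / 2`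
(`le_inner_sqrtDensity`), which passes to the hull, so `v ≠ 0`, and `|v|² ν` normalizes to an
invariant probability measure. -/

/-- The minimal-norm point of a closed convex set is fixed by every linear isometry preserving
the set. -/
lemma exists_mem_forall_linearIsometry_eq {E : Type*} [NormedAddCommGroup E]
    [InnerProductSpace ℝ E] [CompleteSpace E] {K : Set E} (hne : K.Nonempty) (hcl : IsClosed K)
    (hconv : Convex ℝ K) :
    ∃ v ∈ K, ∀ U : E →ₗᵢ[ℝ] E, Set.MapsTo U K K → U v = v := by
  obtain ⟨v, hv, hmin⟩ := exists_norm_eq_iInf_of_complete_convex hne hcl.isComplete hconv 0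
  refine ⟨v, hv, fun U hU => ?_⟩
  -- The variational inequality gives `‖v‖² ≤ ⟪v, U v⟫`, while `‖U v - v‖² = 2‖v‖² - 2⟪v, U v⟫`.
  have h := (norm_eq_iInf_iff_real_inner_le_zero hconv hv).1 hmin (U v) (hU hv)
  rw [zero_sub, inner_neg_left, inner_sub_right, real_inner_self_eq_norm_sq] at h
  have h2 := norm_sub_sq_real (U v) v
  rw [U.norm_map, real_inner_comm] at h2
  have h3 : ‖U v - v‖ ^ 2 ≤ 0 := by linarith
  have h4 : ‖U v - v‖ = 0 := by nlinarith [norm_nonneg (U v - v)]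
  exact sub_eq_zero.1 (norm_eq_zero.1 h4)

/-! ### Half-densities and the isometric action on `L²(ν)` -/

section HalfDensity

variable {X : Type*} [MeasurableSpace X]

/-- If `f` is regarded as the half-density `f √ν`, then this is the density with respect to `√ν`
of its push-forward under `e`. -/
noncomputable def halfDensityMap (ν : Measure X) (e : X ≃ᵐ X) (f : X → ℝ) (x : X) : ℝ :=
  f (e.symm x) * √((ν.map e).rnDeriv ν x).toReal

lemma eLpNorm_two_eq_withDensity (ν : Measure X) (f : X → ℝ) :
    eLpNorm f 2 ν = (ν.withDensity (fun x => ‖f x‖ₑ ^ 2) Set.univ) ^ (1 / 2 : ℝ) := by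
  rw [eLpNorm_eq_lintegral_rpow_enorm_toReal (by simp) (by simp)]
  simp

variable {ν : Measure X} {e : X ≃ᵐ X}

lemma ae_symm_of_map_absolutelyContinuous (he : ν ≪ ν.map e) {p : X → Prop}
    (hp : ∀ᵐ x ∂ν, p x) : ∀ᵐ x ∂ν, p (e.symm x) := by
  have h : ∀ᵐ x ∂ν.map e, p (e.symm x) := by
    rw [e.measurableEmbedding.ae_map_iff]
    simpa using hp
  exact he.ae_le h

lemma aestronglyMeasurable_halfDensityMap (he : ν ≪ ν.map e) {f : X → ℝ}
    (hf : AEStronglyMeasurable f ν) : AEStronglyMeasurable (halfDensityMap ν e f) ν := by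
  have h1 : AEStronglyMeasurable (fun x => f (e.symm x)) ν := by
    refine AEStronglyMeasurable.mono_ac he ?_
    rw [e.measurableEmbedding.aestronglyMeasurable_map_iff]
    simpa [Function.comp_def] using hf
  exact h1.mul (Measure.measurable_rnDeriv _ _).ennreal_toReal.sqrt.aestronglyMeasurable

lemma enorm_halfDensityMap_sq (ν : Measure X) [IsFiniteMeasure ν] (e : X ≃ᵐ X) (f : X → ℝ) :
    (fun x => ‖halfDensityMap ν e f x‖ₑ ^ 2) =ᵐ[ν]
      fun x => (ν.map e).rnDeriv ν x * ‖f (e.symm x)‖ₑ ^ 2 := by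
  filter_upwards [(ν.map e).rnDeriv_lt_top ν] with x hx
  rw [halfDensityMap, enorm_mul, mul_pow, mul_comm, Real.enorm_of_nonneg (Real.sqrt_nonneg _),
    ← ENNReal.ofReal_pow (Real.sqrt_nonneg _), Real.sq_sqrt ENNReal.toReal_nonneg,
    ENNReal.ofReal_toReal hx.ne]

variable [IsFiniteMeasure ν]

/-- Change of variables: the square-root weight squares to the Radon–Nikodym derivative. Both the
isometry property and the invariance of `|v|² ν` for fixed `v` come from this. -/
lemma map_withDensity_enorm_sq (he : ν.map e ≪ ν) (he' : ν ≪ ν.map e) {f : X → ℝ} (hf : AEStronglyMeasurable f ν) :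
    (ν.withDensity fun x => ‖f x‖ₑ ^ 2).map e =
      ν.withDensity fun x => ‖halfDensityMap ν e f x‖ₑ ^ 2 := by
  ext s hs
  have hmeas : AEMeasurable (fun x => ‖f (e.symm x)‖ₑ ^ 2) (ν.map e) := by
    rw [e.measurableEmbedding.aemeasurable_map_iff]
    simpa [Function.comp_def] using hf.enorm.pow_const 2
  rw [Measure.map_apply e.measurable hs, withDensity_apply _ (e.measurable hs),
    withDensity_apply _ hs, lintegral_congr_ae (ae_restrict_of_ae (enorm_halfDensityMap_sq ν e f)),
    setLIntegral_rnDeriv_mul he (hmeas.mono_ac he') hs, e.restrict_map, lintegral_map_equiv]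
  simp

lemma eLpNorm_halfDensityMap (he : ν.map e ≪ ν) (he' : ν ≪ ν.map e) {f : X → ℝ} (hf : AEStronglyMeasurable f ν) :
    eLpNorm (halfDensityMap ν e f) 2 ν = eLpNorm f 2 ν := by
  rw [eLpNorm_two_eq_withDensity, eLpNorm_two_eq_withDensity, ← map_withDensity_enorm_sq he he' hf,
    Measure.map_apply e.measurable MeasurableSet.univ, Set.preimage_univ]

lemma memLp_halfDensityMap (he : ν.map e ≪ ν) (he' : ν ≪ ν.map e) {f : X → ℝ}
    (hf : MemLp f 2 ν) : MemLp (halfDensityMap ν e f) 2 ν :=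
  ⟨aestronglyMeasurable_halfDensityMap he' hf.1, by rw [eLpNorm_halfDensityMap he he' hf.1]; exact hf.2⟩

/-- The unitary action of a nonsingular transformation on half-densities. -/
noncomputable def halfDensityIsometry (he : ν.map e ≪ ν) (he' : ν ≪ ν.map e) :
    Lp ℝ 2 ν →ₗᵢ[ℝ] Lp ℝ 2 ν where
  toFun f := (memLp_halfDensityMap he he' (Lp.memLp f)).toLp
  map_add' f g := by
    ext1
    filter_upwards [MemLp.coeFn_toLp (memLp_halfDensityMap he he' (Lp.memLp (f + g))),
      Lp.coeFn_add (memLp_halfDensityMap he he' (Lp.memLp f)).toLp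
        (memLp_halfDensityMap he he' (Lp.memLp g)).toLp,
      MemLp.coeFn_toLp (memLp_halfDensityMap he he' (Lp.memLp f)),
      MemLp.coeFn_toLp (memLp_halfDensityMap he he' (Lp.memLp g)),
      ae_symm_of_map_absolutelyContinuous he' (Lp.coeFn_add f g)] with x h1 h2 h3 h4 h5
    rw [h1, h2, Pi.add_apply, h3, h4]
    simp only [halfDensityMap, h5, Pi.add_apply, add_mul]
  map_smul' c f := by
    ext1
    filter_upwards [MemLp.coeFn_toLp (memLp_halfDensityMap he he' (Lp.memLp (c • f))),
      Lp.coeFn_smul c (memLp_halfDensityMap he he' (Lp.memLp f)).toLp,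
      MemLp.coeFn_toLp (memLp_halfDensityMap he he' (Lp.memLp f)),
      ae_symm_of_map_absolutelyContinuous he' (Lp.coeFn_smul c f)] with x h1 h2 h3 h4
    rw [h1, RingHom.id_apply, h2, Pi.smul_apply, h3]
    simp only [halfDensityMap, h4, Pi.smul_apply, smul_eq_mul, mul_assoc]
  norm_map' f := by
    simp only [LinearMap.coe_mk, AddHom.coe_mk, Lp.norm_toLp]
    rw [eLpNorm_halfDensityMap he he' (Lp.memLp f).1, Lp.norm_def]

lemma coeFn_halfDensityIsometry (he : ν.map e ≪ ν) (he' : ν ≪ ν.map e) (f : Lp ℝ 2 ν) :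
    halfDensityIsometry he he' f =ᵐ[ν] halfDensityMap ν e f :=
  MemLp.coeFn_toLp (memLp_halfDensityMap he he' (Lp.memLp f))

lemma map_withDensity_of_halfDensityIsometry_eq (he : ν.map e ≪ ν) (he' : ν ≪ ν.map e)
    {f : Lp ℝ 2 ν} (hf : halfDensityIsometry he he' f = f) :
    (ν.withDensity fun x => ‖f x‖ₑ ^ 2).map e = ν.withDensity fun x => ‖f x‖ₑ ^ 2 := by
  rw [map_withDensity_enorm_sq he he' (Lp.memLp f).1]
  refine withDensity_congr_ae ?_
  have h := coeFn_halfDensityIsometry he he' f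
  rw [hf] at h
  filter_upwards [h] with x hx
  rw [hx]

lemma memLp_sqrt_rnDeriv (μ ν : Measure X) [IsFiniteMeasure μ] [IsFiniteMeasure ν] :
    MemLp (fun x => √(μ.rnDeriv ν x).toReal) 2 ν := by
  rw [memLp_two_iff_integrable_sq
    (Measure.measurable_rnDeriv _ _).ennreal_toReal.sqrt.aestronglyMeasurable]
  simpa [Real.sq_sqrt] using Measure.integrable_toReal_rnDeriv

/-- The square root of a finite measure as a half-density. -/
noncomputable def sqrtDensity (ν μ : Measure X) [IsFiniteMeasure ν] [IsFiniteMeasure μ] :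
    Lp ℝ 2 ν :=
  (memLp_sqrt_rnDeriv μ ν).toLp

lemma coeFn_sqrtDensity (μ : Measure X) [IsFiniteMeasure μ] :
    sqrtDensity ν μ =ᵐ[ν] fun x => √(μ.rnDeriv ν x).toReal :=
  MemLp.coeFn_toLp (memLp_sqrt_rnDeriv μ ν)

/-- Square root of the chain rule `d(e_*μ)/dν = d(e_*μ)/d(e_*ν) · d(e_*ν)/dν`. -/
lemma halfDensityIsometry_sqrtDensity (he : ν.map e ≪ ν) (he' : ν ≪ ν.map e) (μ : Measure X)
    [IsFiniteMeasure μ] (hμ : μ ≪ ν) :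
    halfDensityIsometry he he' (sqrtDensity ν μ) = sqrtDensity ν (μ.map e) := by
  ext1
  have hmap := ae_symm_of_map_absolutelyContinuous he'
    (e.measurableEmbedding.rnDeriv_map μ ν)
  have hchain := Measure.rnDeriv_mul_rnDeriv (κ := ν) (hμ.map e.measurable)
  filter_upwards [coeFn_halfDensityIsometry he he' (sqrtDensity ν μ),
    coeFn_sqrtDensity (ν := ν) (μ.map e),
    ae_symm_of_map_absolutelyContinuous he' (coeFn_sqrtDensity (ν := ν) μ), hmap, hchain]
    with x h1 h2 h3 h4 h5
  rw [h1, h2, halfDensityMap, h3, ← h5, Pi.mul_apply, ENNReal.toReal_mul,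
    Real.sqrt_mul ENNReal.toReal_nonneg, ← h4, e.apply_symm_apply]

/-- The Hellinger affinity of two probability measures is bounded below in terms of their total
variation distance. -/
lemma le_inner_sqrtDensity {μ₁ μ₂ : Measure X} [IsProbabilityMeasure μ₁] [IsProbabilityMeasure μ₂]
    (h₁ : μ₁ ≪ ν) (h₂ : μ₂ ≪ ν) {δ : ℝ}
    (h : tvNorm (μ₁.toSignedMeasure - μ₂.toSignedMeasure) ≤ 2 - δ) :
    δ / 2 ≤ ⟪sqrtDensity ν μ₁, sqrtDensity ν μ₂⟫_ℝ := by
  set p : X → ℝ := fun x => (μ₁.rnDeriv ν x).toReal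
  set q : X → ℝ := fun x => (μ₂.rnDeriv ν x).toReal
  have hp : Integrable p ν := Measure.integrable_toReal_rnDeriv
  have hq : Integrable q ν := Measure.integrable_toReal_rnDeriv
  have hp0 : ∀ x, 0 ≤ p x := fun x => ENNReal.toReal_nonneg
  have hq0 : ∀ x, 0 ≤ q x := fun x => ENNReal.toReal_nonneg
  set A : Set X := {x | q x ≤ p x}
  have hA : MeasurableSet A := measurableSet_le (by fun_prop) (by fun_prop)
  have hinner : ⟪sqrtDensity ν μ₁, sqrtDensity ν μ₂⟫_ℝ = ∫ x, √(p x) * √(q x) ∂ν := by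
    rw [L2.inner_def]
    refine integral_congr_ae ?_
    filter_upwards [coeFn_sqrtDensity (ν := ν) μ₁, coeFn_sqrtDensity (ν := ν) μ₂] with x hx hy
    rw [hx, hy]
    simp [p, q, mul_comm]
  have hint : Integrable (fun x => √(p x) * √(q x)) ν :=
    (memLp_sqrt_rnDeriv μ₁ ν).integrable_mul (memLp_sqrt_rnDeriv μ₂ ν)
  have hmint : Integrable (fun x => min (p x) (q x)) ν := hp.inf hq
  have hmin : ∫ x, min (p x) (q x) ∂ν ≤ ∫ x, √(p x) * √(q x) ∂ν := by
    refine integral_mono hmint hint fun x => ?_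
    have hm : 0 ≤ min (p x) (q x) := le_min (hp0 x) (hq0 x)
    calc min (p x) (q x) = √(min (p x) (q x)) * √(min (p x) (q x)) := (Real.mul_self_sqrt hm).symm
      _ ≤ √(p x) * √(q x) := by
        gcongr
        · exact min_le_left _ _
        · exact min_le_right _ _
  have hsplit : ∫ x, min (p x) (q x) ∂ν = μ₂.real A + μ₁.real Aᶜ := by
    rw [← integral_add_compl hA hmint, ← Measure.setIntegral_toReal_rnDeriv h₂ A,
      ← Measure.setIntegral_toReal_rnDeriv h₁ Aᶜ]
    congr 1
    · exact setIntegral_congr_fun hA fun x hx => min_eq_right hx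
    · exact setIntegral_congr_fun hA.compl fun x hx => min_eq_left (le_of_not_ge hx : p x ≤ q x)
  set s := μ₁.toSignedMeasure - μ₂.toSignedMeasure
  have hs : ∀ B, MeasurableSet B → s B = μ₁.real B - μ₂.real B := fun B hB =>
    Measure.toSignedMeasure_sub_apply hB
  have htv : s.totalVariation.real A + s.totalVariation.real Aᶜ ≤ 2 - δ := by
    rw [measureReal_add_measureReal_compl hA]
    exact h
  -- Since `s Aᶜ = -s A`, both pieces of the total variation are at least `s A`. Thus `2 * s A ≤ 2 -
  -- δ`, and the integral of the minimum is `1 - s A ≥ δ / 2`.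
  have hbA := (le_abs_self _).trans (s.norm_le_totalVariation A)
  have hbA' := (neg_le_abs _).trans (s.norm_le_totalVariation Aᶜ)
  rw [hs A hA] at hbA
  rw [hs Aᶜ hA.compl] at hbA'
  have e₁ := probReal_add_probReal_compl (μ := μ₁) hA
  have e₂ := probReal_add_probReal_compl (μ := μ₂) hA
  linarith

end HalfDensity

/-- A countable group of measurable transformations that moves a probability measure by at most
`2 - δ` in total variation has an invariant probability measure. -/
lemma exists_invariant_of_countable {H X : Type*} [Group H] [Countable H] [MeasurableSpace X]
    [MulAction H X] [MeasurableConstSMul H X] (α : Measure X) [IsProbabilityMeasure α] {δ : ℝ}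
    (hδ : 0 < δ)
    (hα : ∀ g : H, tvNorm ((measureTranslate g α).toSignedMeasure - α.toSignedMeasure) ≤ 2 - δ) :
    ∃ β : Measure X, IsProbabilityMeasure β ∧ ∀ g : H, measureTranslate g β = β := by
  let T : H → X ≃ᵐ X := MeasurableEquiv.smul
  -- `σ` is exactly invariant but may be infinite; the equivalent finite measure `ν` is only
  -- quasi-invariant.
  let σ : Measure X := Measure.sum fun g : H => α.map (T g)
  let ν : Measure X := σ.toFinite
  have hmap : ∀ g h : H, (α.map (T h)).map (T g) = α.map (T (g * h)) := fun g h => by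
    rw [Measure.map_map (T g).measurable (T h).measurable]
    congr 1
    ext x
    simp [T, mul_smul]
  have hσ : ∀ g : H, σ.map (T g) = σ := fun g => by
    simp only [σ]
    rw [Measure.map_sum (T g).measurable.aemeasurable]
    simp only [hmap]
    exact Measure.sum_comp_equiv (Equiv.mulLeft g) fun h => α.map (T h)
  have hνσ : ν ≪ σ := toFinite_absolutelyContinuous σ
  have hσν : σ ≪ ν := absolutelyContinuous_toFinite σ
  have he : ∀ g, ν.map (T g) ≪ ν := fun g => by
    have := hνσ.map (T g).measurable
    rw [hσ] at this
    exact this.trans hσν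
  have he' : ∀ g, ν ≪ ν.map (T g) := fun g => by
    have := hσν.map (T g).measurable
    rw [hσ] at this
    exact hνσ.trans this
  have hac : ∀ g : H, α.map (T g) ≪ ν := fun g =>
    (Measure.absolutelyContinuous_sum_right g Measure.AbsolutelyContinuous.rfl).trans hσν
  have hα1 : α.map (T 1) = α := by
    have : (T 1 : X → X) = id := by ext x; simp [T]
    rw [this, Measure.map_id]
  have hαν : α ≪ ν := hα1 ▸ hac 1
  have hprob : ∀ g, IsProbabilityMeasure (α.map (T g)) := fun g =>
    Measure.isProbabilityMeasure_map (T g).measurable.aemeasurable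
  let S : Set (Lp ℝ 2 ν) := Set.range fun g : H => sqrtDensity ν (α.map (T g))
  have hK : IsClosed (closure (convexHull ℝ S)) := isClosed_closure
  obtain ⟨v, hvK, hv⟩ := exists_mem_forall_linearIsometry_eq
    (K := closure (convexHull ℝ S)) ((Set.range_nonempty _).convexHull.closure) hK
    (convex_convexHull ℝ S).closure
  have hinner : δ / 2 ≤ ⟪v, sqrtDensity ν α⟫_ℝ := by
    have hclosed : IsClosed {w : Lp ℝ 2 ν | δ / 2 ≤ ⟪w, sqrtDensity ν α⟫_ℝ} :=
      isClosed_le continuous_const (by fun_prop)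
    have hcvx : Convex ℝ {w : Lp ℝ 2 ν | δ / 2 ≤ ⟪w, sqrtDensity ν α⟫_ℝ} :=
      convex_halfSpace_ge
        ⟨fun x y => inner_add_left _ _ _, fun c x => real_inner_smul_left _ _ _⟩ _
    refine closure_minimal (convexHull_min ?_ hcvx) hclosed hvK
    rintro _ ⟨g, rfl⟩
    exact le_inner_sqrtDensity (hac g) hαν (hα g)
  have hv0 : v ≠ 0 := by
    rintro rfl
    rw [inner_zero_left] at hinner
    linarith
  have hfix : ∀ g, halfDensityIsometry (he g) (he' g) v = v := fun g => by
    refine hv _ ?_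
    have hS : Set.MapsTo (halfDensityIsometry (he g) (he' g)) S S := by
      rintro _ ⟨h, rfl⟩
      refine ⟨g * h, ?_⟩
      simp only [halfDensityIsometry_sqrtDensity _ _ _ (hac h), hmap]
    refine Set.MapsTo.closure ?_ (halfDensityIsometry (he g) (he' g)).continuous
    rw [Set.mapsTo_iff_image_subset]
    have := (halfDensityIsometry (he g) (he' g)).toLinearMap.image_convexHull S
    rw [LinearIsometry.coe_toLinearMap] at this
    rw [this]
    exact convexHull_mono hS.image_subset
  let β : Measure X := ν.withDensity fun x => ‖v x‖ₑ ^ 2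
  have hβ : ∀ g : H, β.map (T g) = β := fun g =>
    map_withDensity_of_halfDensityIsometry_eq (he g) (he' g) (hfix g)
  have hnorm := eLpNorm_two_eq_withDensity ν v
  have hβtop : β Set.univ ≠ ∞ := fun htop => by
    change _ = β Set.univ ^ (1 / 2 : ℝ) at hnorm
    rw [htop, ENNReal.top_rpow_of_pos (by norm_num)] at hnorm
    exact (Lp.memLp v).2.ne hnorm
  have hβ0 : β Set.univ ≠ 0 := fun hz => by
    change _ = β Set.univ ^ (1 / 2 : ℝ) at hnorm
    rw [hz, ENNReal.zero_rpow_of_pos (by norm_num)] at hnorm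
    apply hv0
    rw [← norm_eq_zero, Lp.norm_def, hnorm, ENNReal.toReal_zero]
  refine ⟨(β Set.univ)⁻¹ • β, ⟨?_⟩, fun g => ?_⟩
  · rw [Measure.smul_apply, smul_eq_mul, ENNReal.inv_mul_cancel hβ0 hβtop]
  · rw [measureTranslate, Measure.map_smul]
    exact congrArg _ (hβ g)

theorem theorem3p4 {G X : Type*} [Group G] [TopologicalSpace X] [CompactSpace X]
    [TopologicalSpace.MetrizableSpace X] [MeasurableSpace X] [BorelSpace X]
    [MulAction G X] [ContinuousConstSMul G X]
    (α : Measure X) [IsProbabilityMeasure α] (δ : ℝ) (hδ : 0 < δ)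
    (hα : ∀ g : G, tvNorm ((measureTranslate g α).toSignedMeasure - α.toSignedMeasure) ≤ 2 - δ) :
    ∃ β : Measure X, IsProbabilityMeasure β ∧ ∀ g : G, measureTranslate g β = β := by
  have hcont : ∀ g : G, Continuous fun x : X => g • x := continuous_const_smul
  let C : G → Set (ProbabilityMeasure X) := fun g => {β | β.map (hcont g).aemeasurable = β}
  have hC : ∀ g, IsClosed (C g) := fun g =>
    isClosed_eq (ProbabilityMeasure.continuous_map (hcont g)) continuous_id
  have hfin : ∀ F : Finset G, (⋂ g ∈ F, C g).Nonempty := fun F => by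
    let H : Subgroup G := Subgroup.closure (F : Set G)
    have : Countable H := by
      -- `H` is a quotient of the free group on the finite set `F`.
      rw [show H = _ from FreeGroup.closure_eq_range (F : Set G)]
      exact (MonoidHom.rangeRestrict_surjective _).countable
    obtain ⟨β, hβ, hinv⟩ := exists_invariant_of_countable (H := H) α hδ fun g => hα g
    refine ⟨⟨β, hβ⟩, Set.mem_iInter₂.2 fun g hg => Subtype.ext ?_⟩
    exact hinv ⟨g, Subgroup.subset_closure hg⟩
  obtain ⟨β, hβ⟩ := CompactSpace.iInter_nonempty hC hfin
  exact ⟨β, β.2, fun g => congrArg Subtype.val (Set.mem_iInter.1 hβ g)⟩
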